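/- Let $F$ be a field and let $\mathfrak g$ be a (right) Leibniz algebra over $F$, i.e. a vector space with a bilinear bracket satisfying $[x,[y,z]]=[[x,y],z]-[[x,z],y]$. For a two-sided ideal $\mathfrak n$ of $\mathfrak g$ write $[\mathfrak g,\mathfrak n]$ for the span of all $[x,a]$, $[a,x]$ ($x\in\mathfrak g$, $a\in\mathfrak n$), and $Z(\mathfrak g,\mathfrak n)=\{z\in\mathfrak n : [x,z]=[z,x]=0 \text{ for all } x\in\mathfrak g\}$. Relative homology. Let $CL_n(\mathfrak g)=\mathfrak g^{\otimes n}$ with $\partial(x_1\otimes\cdots\otimes x_n)=\sum_{i<j}(-1)^j x_1\otimes\cdots\otimes[x_i,x_j]\otimes\cdots\otimes\widehat{x_j}\otimes\cdots\otimes x_n$, and let $M_*$ be the mapping cone of the map $\pi: CL_*(\mathfrak g)\to CL_*(\mathfrak g/\mathfrak n)$, so $M_n=CL_{n-1}(\mathfrak g)\oplus CL_n(\mathfrak g/\mathfrak n)$ and $\delta(a,b)=(-\partial a,\bar\partial b+\pi a)$. Then $HL_2(\mathfrak g,\mathfrak n):=H_3(M_*)$, regarded as an abelian Leibniz algebra.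 Exterior product. For an ideal $\mathfrak k$ of $\mathfrak g$, the non-abelian tensor product $\mathfrak g\ast\mathfrak k$ is the Leibniz algebra generated by two disjoint families of symbols $x\ast a$ and $a\ast x$ ($x\in\mathfrak g$, $a\in\mathfrak k$), bilinear in their entries, subject, for $(A,B)=(\mathfrak g,\mathfrak k)$ and for $(A,B)=(\mathfrak k,\mathfrak g)$ and all $p,p'\in A$, $q,q'\in B$, to $p\ast[q,q']=[p,q]\ast q'-[p,q']\ast q$, $\;[p,p']\ast q=[p,q]\ast p'-p\ast[q,p']$, $\;p\ast[p',q]=-p\ast[q,p']$, and to the following relations for any two generators $u\ast v$, $u'\ast v'$ (of either family): $[u\ast v,u'\ast v']=[u,v]\ast[u',v']$, where the right-hand side may be read in either family. (In the second relation $[p,q]\in B$, so $[p,q]\ast p'$ belongs to the other family.) The exterior product $\mathfrak g\curlywedge\mathfrak k$ is the quotient of $\mathfrak g\ast\mathfrak k$ by the (central) span of the elements $a\ast a'-a\ast' a'$ with $a,a'\in\mathfrak k$, where $a\ast a'$ is formed with $a\in\mathfrak g$, $a'\in\mathfrak k$ and $a\ast' a'$ with $a\in\mathfrak k$, $a'\in\mathfrak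 g$. The images of $x\ast a$ and $a\ast x$ are written $x\curlywedge a$ and $a\curlywedge x$. **Proposition.** Let $\mathfrak n$ and $\mathfrak k$ be ideals of $\mathfrak g$ with $\mathfrak k\subseteq Z(\mathfrak g,\mathfrak n)$. Then there is an exact sequence of Leibniz algebras $$\mathfrak g\curlywedge\mathfrak k\xrightarrow{\ \alpha\ }HL_2(\mathfrak g,\mathfrak n)\xrightarrow{\ \beta\ }HL_2(\mathfrak g/\mathfrak k,\mathfrak n/\mathfrak k)\xrightarrow{\ \gamma\ }[\mathfrak g,\mathfrak n]\cap\mathfrak k\to 0,$$ i.e. $\operatorname{im}\alpha=\ker\beta$, $\operatorname{im}\beta=\ker\gamma$ and $\gamma$ is surjective. Here $\beta$ is induced by the projection $\mathfrak g\to\mathfrak g/\mathfrak k$; $\alpha$ sends $x\curlywedge a$ and $a\curlywedge x$ to the classes of $(x\otimes a,0)$ and $(a\otimes x,0)$; and if $u\in\mathfrak g\otimes\mathfrak g$ maps to $0$ in $(\mathfrak g/\mathfrak n)^{\otimes 2}$ and its image $\bar u$ in $(\mathfrak g/\mathfrak k)^{\otimes 2}$ is such that $(\bar u,0)$ is a cycle,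 then $\gamma$ sends the class of $(\bar u,0)$ to $\partial u\in CL_1(\mathfrak g)=\mathfrak g$. -/

import Mathlib

open scoped TensorProduct

/-- A (right) Leibniz algebra over a field `F`: a vector space with a bilinear bracket
`br F x y = [x, y]` such that `[x, [y, z]] = [[x, y], z] - [[x, z], y]`. -/
class LeibnizAlgebra (F : Type*) (g : Type*) [Field F] [AddCommGroup g] [Module F g] where
  bracket : g →ₗ[F] g →ₗ[F] g
  leibniz : ∀ x y z : g,
    bracket x (bracket y z) = bracket (bracket x y) z - bracket (bracket x z) y

namespace Leib

universe u v w w'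

section Basic

variable (F : Type u) {g : Type v} {h : Type w} [Field F]
  [AddCommGroup g] [Module F g] [LeibnizAlgebra F g]
  [AddCommGroup h] [Module F h] [LeibnizAlgebra F h]

/-- The bracket `[x, y]`. -/
def br (x y : g) : g := LeibnizAlgebra.bracket (F := F) x y

theorem br_leibniz (x y z : g) : br F x (br F y z) = br F (br F x y) z - br F (br F x z) y :=
  LeibnizAlgebra.leibniz x y z

variable (g h)

/-- Homomorphisms of Leibniz algebras. -/
structure Hom extends g →ₗ[F] h where
  map_br : ∀ x y : g, toFun (br F x y) = br F (toFun x) (toFun y)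

instance : CoeFun (Hom F g h) (fun _ => g → h) := ⟨fun f => f.toLinearMap⟩

/-- Two-sided ideals. -/
structure Ideal extends Submodule F g where
  br_left_mem : ∀ (x : g) {a : g}, a ∈ carrier → br F x a ∈ carrier
  br_right_mem : ∀ {a : g} (x : g), a ∈ carrier → br F a x ∈ carrier

instance : CoeSort (Ideal F g) (Type v) := ⟨fun I => I.toSubmodule⟩

variable {F g h}

/-- An ideal is a Leibniz algebra under the restricted bracket. -/
instance idealLeibniz (I : Ideal F g) : LeibnizAlgebra F I.toSubmodule where
  bracket := LinearMap.mk₂ F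
    (fun a b => ⟨br F (a : g) (b : g), I.br_left_mem (a : g) b.2⟩)
    (fun a a' b => Subtype.ext (by simp [br]))
    (fun c a b => Subtype.ext (by simp [br]))
    (fun a b b' => Subtype.ext (by simp [br]))
    (fun c a b => Subtype.ext (by simp [br]))
  leibniz x y z := Subtype.ext (br_leibniz F (x : g) (y : g) (z : g))

/-- A bilinear map descends to the quotient by a subspace absorbing it on both sides. -/
def quotBilin {V : Type*} [AddCommGroup V] [Module F V] (B : V →ₗ[F] V →ₗ[F] V)
    (I : Submodule F V) (hl : ∀ x, ∀ a ∈ I, B x a ∈ I) (hr : ∀ x, ∀ a ∈ I, B a x ∈ I) :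
    (V ⧸ I) →ₗ[F] (V ⧸ I) →ₗ[F] (V ⧸ I) :=
  I.liftQ
    { toFun := fun x => I.mapQ I (B x) (fun a ha => hl x a ha)
      map_add' := fun x y => by ext; simp
      map_smul' := fun c x => by ext; simp }
    (fun a ha => by
      ext x
      simpa using hr x a ha)

/-- The quotient `g / I`. -/
def Quo (I : Ideal F g) : Type v := g ⧸ I.toSubmodule

instance (I : Ideal F g) : AddCommGroup (Quo I) := inferInstanceAs (AddCommGroup (g ⧸ I.toSubmodule))

instance (I : Ideal F g) : Module F (Quo I) := inferInstanceAs (Module F (g ⧸ I.toSubmodule))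

/-- The quotient `g / I` is a Leibniz algebra under the induced bracket. -/
instance quotientLeibniz (I : Ideal F g) : LeibnizAlgebra F (Quo I) where
  bracket := quotBilin (LeibnizAlgebra.bracket (F := F)) I.toSubmodule
    (fun x _ ha => I.br_left_mem x ha) (fun x _ ha => I.br_right_mem x ha)
  leibniz x y z := by
    obtain ⟨x, rfl⟩ := Submodule.Quotient.mk_surjective _ x
    obtain ⟨y, rfl⟩ := Submodule.Quotient.mk_surjective _ y
    obtain ⟨z, rfl⟩ := Submodule.Quotient.mk_surjective _ z
    exact congrArg (Submodule.Quotient.mk (p := I.toSubmodule)) (br_leibniz F x y z)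

/-- The projection `g → g / I`. -/
def Ideal.proj (I : Ideal F g) : Hom F g (Quo I) where
  toLinearMap := I.toSubmodule.mkQ
  map_br _ _ := rfl

theorem Ideal.proj_surjective (I : Ideal F g) : Function.Surjective I.proj :=
  Submodule.Quotient.mk_surjective _

theorem Ideal.proj_eq_zero (I : Ideal F g) (x : g) : I.proj x = 0 ↔ x ∈ I.toSubmodule :=
  Submodule.Quotient.mk_eq_zero _

/-- For ideals `n` and `k` of `g`, the image of `n` in `g / k`; this is `n / k` if `k ⊆ n`. -/
def Ideal.quot (n k : Ideal F g) : Ideal F (Quo k) where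
  toSubmodule := n.toSubmodule.map k.proj.toLinearMap
  br_left_mem := by
    rintro x _ ⟨a, ha, rfl⟩
    obtain ⟨x, rfl⟩ := k.proj_surjective x
    exact ⟨br F x a, n.br_left_mem x ha, rfl⟩
  br_right_mem := by
    rintro _ x ⟨a, ha, rfl⟩
    obtain ⟨x, rfl⟩ := k.proj_surjective x
    exact ⟨br F a x, n.br_right_mem x ha, rfl⟩

/-- The intersection of two ideals. -/
instance : Min (Ideal F g) where
  min I J :=
    { toSubmodule := I.toSubmodule ⊓ J.toSubmodule
      br_left_mem := fun x _ ha => ⟨I.br_left_mem x ha.1, J.br_left_mem x ha.2⟩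
      br_right_mem := fun x ha => ⟨I.br_right_mem x ha.1, J.br_right_mem x ha.2⟩ }

/-- The commutator `[g, n]`: the span of all `[x, a]` and `[a, x]` with `x ∈ g`, `a ∈ n`. -/
def commutator (n : Ideal F g) : Ideal F g :=
  have hle : Submodule.span F {y : g | ∃ x : g, ∃ a ∈ n.toSubmodule, y = br F x a ∨ y = br F a x}
      ≤ n.toSubmodule := by
    rw [Submodule.span_le]
    rintro y ⟨x, a, ha, rfl | rfl⟩
    · exact n.br_left_mem x ha
    · exact n.br_right_mem x ha
  { toSubmodule :=
      Submodule.span F {y : g | ∃ x : g, ∃ a ∈ n.toSubmodule, y = br F x a ∨ y = br F a x}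
    br_left_mem := fun x a ha => Submodule.subset_span ⟨x, a, hle ha, Or.inl rfl⟩
    br_right_mem := fun {a} x ha => Submodule.subset_span ⟨x, a, hle ha, Or.inr rfl⟩ }

/-- `Z(g, n) = Z(g) ∩ n`, where `Z(g)` is the (two-sided) centre of `g`. -/
def relCenter (n : Ideal F g) : Submodule F g where
  carrier := {z | z ∈ n.toSubmodule ∧ ∀ x : g, br F x z = 0 ∧ br F z x = 0}
  add_mem' := by
    rintro a b ⟨ha, ha'⟩ ⟨hb, hb'⟩
    refine ⟨add_mem ha hb, fun x => ⟨?_, ?_⟩⟩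
    · have h1 := (ha' x).1
      have h2 := (hb' x).1
      simp only [br] at h1 h2 ⊢
      simp [h1, h2]
    · have h1 := (ha' x).2
      have h2 := (hb' x).2
      simp only [br] at h1 h2 ⊢
      simp [h1, h2]
  zero_mem' := ⟨zero_mem _, fun x => by simp [br]⟩
  smul_mem' := by
    rintro c a ⟨ha, ha'⟩
    refine ⟨Submodule.smul_mem _ c ha, fun x => ⟨?_, ?_⟩⟩
    · have h1 := (ha' x).1
      simp only [br] at h1 ⊢
      simp [h1]
    · have h1 := (ha' x).2
      simp only [br] at h1 ⊢
      simp [h1]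

end Basic

section Crossed

variable (F : Type u) (m : Type w) (g : Type v) [Field F]
  [AddCommGroup m] [Module F m] [LeibnizAlgebra F m]
  [AddCommGroup g] [Module F g] [LeibnizAlgebra F g]

/-- An action of the Leibniz algebra `g` on the Leibniz algebra `m`;
`left x a` is `ˣa` and `right a x` is `aˣ`. -/
structure LeibAction where
  left : g →ₗ[F] m →ₗ[F] m
  right : m →ₗ[F] g →ₗ[F] m
  left_br : ∀ x x' a, left (br F x x') a = left x (left x' a) + right (left x a) x'
  right_br : ∀ x x' a, right a (br F x x') = right (right a x) x' - right (right a x') x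
  left_left : ∀ x x' a, left x (left x' a) = - left x (right a x')
  left_of_br : ∀ x a a', left x (br F a a') = br F (left x a) a' - br F (left x a') a
  right_of_br : ∀ x a a', right (br F a a') x = br F (right a x) a' + br F a (right a' x)
  br_left : ∀ x a a', br F a (left x a') = - br F a (right a' x)

/-- A crossed module of Leibniz algebras `m → g`. -/
structure CrossedModule extends LeibAction F m g where
  hom : Hom F m g
  hom_left : ∀ x a, hom (left x a) = br F x (hom a)
  hom_right : ∀ x a, hom (right a x) = br F (hom a) x
  left_hom : ∀ a a', left (hom a) a' = br F a a'
  right_hom : ∀ a a', right a (hom a') = br F a a'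

/-- The identity crossed module `g → g`. -/
def CrossedModule.id : CrossedModule F g g where
  left := LeibnizAlgebra.bracket
  right := LeibnizAlgebra.bracket
  left_br x x' a := by
    have := br_leibniz F x x' a
    simp only [br] at *
    rw [this]; abel
  right_br x x' a := br_leibniz F a x x'
  left_left x x' a := by
    have h1 := br_leibniz F x x' a
    have h2 := br_leibniz F x a x'
    simp only [br] at *
    rw [h1, h2]; abel
  left_of_br x a a' := br_leibniz F x a a'
  right_of_br x a a' := by
    have := br_leibniz F a a' x
    simp only [br] at *
    rw [this]; abel
  br_left x a a' := by
    have h1 := br_leibniz F a x a'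
    have h2 := br_leibniz F a a' x
    simp only [br] at *
    rw [h1, h2]; abel
  hom := { toLinearMap := LinearMap.id, map_br := fun _ _ => rfl }
  hom_left _ _ := rfl
  hom_right _ _ := rfl
  left_hom _ _ := rfl
  right_hom _ _ := rfl

variable {F g}

/-- The crossed module given by the inclusion of an ideal `I ⊆ g`, with `g` acting on `I`
by the bracket of `g`. -/
def Ideal.crossed (I : Ideal F g) : CrossedModule F I.toSubmodule g where
  left := LinearMap.mk₂ F (fun x a => ⟨br F x (a : g), I.br_left_mem x a.2⟩)
    (fun x x' a => Subtype.ext (by simp [br]))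
    (fun c x a => Subtype.ext (by simp [br]))
    (fun x a a' => Subtype.ext (by simp [br]))
    (fun c x a => Subtype.ext (by simp [br]))
  right := LinearMap.mk₂ F (fun a x => ⟨br F (a : g) x, I.br_right_mem x a.2⟩)
    (fun x x' a => Subtype.ext (by simp [br]))
    (fun c x a => Subtype.ext (by simp [br]))
    (fun x a a' => Subtype.ext (by simp [br]))
    (fun c x a => Subtype.ext (by simp [br]))
  left_br x x' a := Subtype.ext ((CrossedModule.id F g).left_br x x' a)
  right_br x x' a := Subtype.ext ((CrossedModule.id F g).right_br x x' a)
  left_left x x' a := Subtype.ext ((CrossedModule.id F g).left_left x x' a)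
  left_of_br x a a' := Subtype.ext ((CrossedModule.id F g).left_of_br x a a')
  right_of_br x a a' := Subtype.ext ((CrossedModule.id F g).right_of_br x a a')
  br_left x a a' := Subtype.ext ((CrossedModule.id F g).br_left x a a')
  hom := { toLinearMap := I.toSubmodule.subtype, map_br := fun _ _ => rfl }
  hom_left _ _ := rfl
  hom_right _ _ := rfl
  left_hom _ _ := rfl
  right_hom _ _ := rfl

end Crossed

section Presented

variable {F : Type u} {X : Type v} [Field F]

/-- The smallest two-sided ideal of the free non-associative algebra on `X` that contains
`rels` and all `x(yz) - ((xy)z - (xz)y)`. -/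
noncomputable def presIdeal (rels : Set (FreeNonUnitalNonAssocAlgebra F X)) :
    Submodule F (FreeNonUnitalNonAssocAlgebra F X) :=
  sInf {I | (∀ a, ∀ b ∈ I, a * b ∈ I ∧ b * a ∈ I) ∧
    (∀ x y z, x * (y * z) - ((x * y) * z - (x * z) * y) ∈ I) ∧ rels ⊆ I}

theorem presIdeal_mul_mem (rels : Set (FreeNonUnitalNonAssocAlgebra F X))
    (a b : FreeNonUnitalNonAssocAlgebra F X) (hb : b ∈ presIdeal rels) :
    a * b ∈ presIdeal rels ∧ b * a ∈ presIdeal rels := by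
  simp only [presIdeal, Submodule.mem_sInf] at *
  exact ⟨fun I hI => (hI.1 a b (hb I hI)).1, fun I hI => (hI.1 a b (hb I hI)).2⟩

theorem presIdeal_leibniz (rels : Set (FreeNonUnitalNonAssocAlgebra F X))
    (x y z : FreeNonUnitalNonAssocAlgebra F X) :
    x * (y * z) - ((x * y) * z - (x * z) * y) ∈ presIdeal rels := by
  simp only [presIdeal, Submodule.mem_sInf]
  exact fun I hI => hI.2.1 x y z

theorem subset_presIdeal (rels : Set (FreeNonUnitalNonAssocAlgebra F X)) :
    rels ⊆ presIdeal rels := by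
  intro r hr
  simp only [presIdeal, SetLike.mem_coe, Submodule.mem_sInf]
  exact fun I hI => hI.2.2 hr

/-- The Leibniz algebra generated by the symbols `X` subject to the relations `r = 0`,
`r ∈ rels`. -/
def Presented (rels : Set (FreeNonUnitalNonAssocAlgebra F X)) : Type (max u v) :=
  FreeNonUnitalNonAssocAlgebra F X ⧸ presIdeal rels

namespace Presented

variable (rels : Set (FreeNonUnitalNonAssocAlgebra F X))

noncomputable instance : AddCommGroup (Presented rels) :=
  inferInstanceAs (AddCommGroup (FreeNonUnitalNonAssocAlgebra F X ⧸ presIdeal rels))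

noncomputable instance : Module F (Presented rels) :=
  inferInstanceAs (Module F (FreeNonUnitalNonAssocAlgebra F X ⧸ presIdeal rels))

/-- The quotient map from the free non-associative algebra. -/
noncomputable def mk : FreeNonUnitalNonAssocAlgebra F X →ₗ[F] Presented rels := (presIdeal rels).mkQ

theorem mk_surjective : Function.Surjective (mk rels) := Submodule.Quotient.mk_surjective _

noncomputable instance : LeibnizAlgebra F (Presented rels) where
  bracket := quotBilin (LinearMap.mul F (FreeNonUnitalNonAssocAlgebra F X)) (presIdeal rels)
    (fun x a ha => (presIdeal_mul_mem rels x a ha).1)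
    (fun x a ha => (presIdeal_mul_mem rels x a ha).2)
  leibniz x y z := by
    obtain ⟨x, rfl⟩ := mk_surjective rels x
    obtain ⟨y, rfl⟩ := mk_surjective rels y
    obtain ⟨z, rfl⟩ := mk_surjective rels z
    exact (Submodule.Quotient.eq _).2 (presIdeal_leibniz rels x y z)

theorem br_mk (a b : FreeNonUnitalNonAssocAlgebra F X) :
    br F (mk rels a) (mk rels b) = mk rels (a * b) := rfl

/-- The image of a generating symbol. -/
noncomputable def gen (s : X) : Presented rels := mk rels (FreeNonUnitalNonAssocAlgebra.of F s)

/-- An element commuting with all generators is central. -/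
theorem central_of_gen (c : Presented rels)
    (hc : ∀ s : X, br F c (gen rels s) = 0 ∧ br F (gen rels s) c = 0) (y : Presented rels) :
    br F c y = 0 ∧ br F y c = 0 := by
  obtain ⟨a, rfl⟩ := mk_surjective rels y
  have hmul : ∀ y z : Presented rels, (br F c y = 0 ∧ br F y c = 0) →
      (br F c z = 0 ∧ br F z c = 0) → (br F c (br F y z) = 0 ∧ br F (br F y z) c = 0) := by
    rintro y z ⟨h1, h2⟩ ⟨h3, h4⟩
    have e1 := br_leibniz F c y z
    have e2 := br_leibniz F y z c
    rw [h1, h3] at e1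
    rw [h4, h2] at e2
    simp only [br, map_zero, LinearMap.zero_apply, sub_zero] at e1 e2 ⊢
    exact ⟨e1, e2.symm⟩
  have hw : ∀ w : FreeMagma X,
      br F c (mk rels (MonoidAlgebra.single w (1 : F))) = 0 ∧
      br F (mk rels (MonoidAlgebra.single w (1 : F))) c = 0 := by
    intro w
    induction w using FreeMagma.recOnMul with
    | ih1 s => exact hc s
    | ih2 p q hp hq =>
      have := hmul _ _ hp hq
      rw [br_mk, MonoidAlgebra.single_mul_single, one_mul] at this
      exact this
  induction a using MonoidAlgebra.induction_linear with
  | zero => simp [br]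
  | add p q hp hq =>
    simp only [br] at hp hq ⊢
    simp [hp.1, hp.2, hq.1, hq.2]
  | single w r =>
    have : (MonoidAlgebra.single w r : MonoidAlgebra F (FreeMagma X))
        = r • MonoidAlgebra.single w (1 : F) := by simp
    have h2 := hw w
    rw [this, map_smul]
    simp only [br] at h2 ⊢
    simp [h2.1, h2.2]

end Presented

end Presented

section Tensor

variable {F : Type u} {g : Type v} {m : Type w} {n : Type w'} [Field F]
  [AddCommGroup g] [Module F g] [LeibnizAlgebra F g]
  [AddCommGroup m] [Module F m] [LeibnizAlgebra F m]
  [AddCommGroup n] [Module F n] [LeibnizAlgebra F n]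

variable (F m n) in
/-- The free non-associative algebra on the symbols `a ∗ b` and `b ∗ a`
(`a ∈ m`, `b ∈ n`), these being two disjoint families. -/
abbrev TensorFree := FreeNonUnitalNonAssocAlgebra F ((m × n) ⊕ (n × m))

variable (F) in
/-- The symbol `a ∗ b` with `a ∈ m`, `b ∈ n`. -/
noncomputable abbrev sMN (a : m) (b : n) : TensorFree F m n := FreeNonUnitalNonAssocAlgebra.of F (Sum.inl (a, b))

variable (F) in
/-- The symbol `b ∗ a` with `b ∈ n`, `a ∈ m`. -/
noncomputable abbrev sNM (b : n) (a : m) : TensorFree F m n := FreeNonUnitalNonAssocAlgebra.of F (Sum.inr (b, a))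

/-- For crossed modules `M : m → g` and `N : n → g`, the algebras `m` and `n` act on each other
through `g`. The defining relations (left side = right side) of the non-abelian tensor product
`m ∗ n` of Leibniz algebras. -/
inductive TensorRel (M : CrossedModule F m g) (N : CrossedModule F n g) :
    TensorFree F m n → TensorFree F m n → Prop
  | smul_mn₁ (c : F) (a : m) (b : n) : TensorRel M N (c • sMN F a b) (sMN F (c • a) b)
  | smul_mn₂ (c : F) (a : m) (b : n) : TensorRel M N (c • sMN F a b) (sMN F a (c • b))
  | smul_nm₁ (c : F) (b : n) (a : m) : TensorRel M N (c • sNM F b a) (sNM F (c • b) a)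
  | smul_nm₂ (c : F) (b : n) (a : m) : TensorRel M N (c • sNM F b a) (sNM F b (c • a))
  | add_mn₁ (a a' : m) (b : n) : TensorRel M N (sMN F (a + a') b) (sMN F a b + sMN F a' b)
  | add_nm₁ (b b' : n) (a : m) : TensorRel M N (sNM F (b + b') a) (sNM F b a + sNM F b' a)
  | add_mn₂ (a : m) (b b' : n) : TensorRel M N (sMN F a (b + b')) (sMN F a b + sMN F a b')
  | add_nm₂ (b : n) (a a' : m) : TensorRel M N (sNM F b (a + a')) (sNM F b a + sNM F b a')
  | r3a (a : m) (b b' : n) : TensorRel M N (sMN F a (br F b b'))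
      (sMN F (M.right a (N.hom b)) b' - sMN F (M.right a (N.hom b')) b)
  | r3b (b : n) (a a' : m) : TensorRel M N (sNM F b (br F a a'))
      (sNM F (N.right b (M.hom a)) a' - sNM F (N.right b (M.hom a')) a)
  | r3c (a a' : m) (b : n) : TensorRel M N (sMN F (br F a a') b)
      (sNM F (N.left (M.hom a) b) a' - sMN F a (N.right b (M.hom a')))
  | r3d (b b' : n) (a : m) : TensorRel M N (sNM F (br F b b') a)
      (sMN F (M.left (N.hom b) a) b' - sNM F b (M.right a (N.hom b')))
  | r4a (a a' : m) (b : n) : TensorRel M N (sMN F a (N.left (M.hom a') b))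
      (- sMN F a (N.right b (M.hom a')))
  | r4b (b b' : n) (a : m) : TensorRel M N (sNM F b (M.left (N.hom b') a))
      (- sNM F b (M.right a (N.hom b')))
  | r5a₁ (a a' : m) (b b' : n) : TensorRel M N (sMN F a b * sMN F a' b')
      (sMN F (M.right a (N.hom b)) (N.left (M.hom a') b'))
  | r5a₂ (a a' : m) (b b' : n) : TensorRel M N (sMN F a b * sMN F a' b')
      (sNM F (N.left (M.hom a) b) (M.right a' (N.hom b')))
  | r5b₁ (a a' : m) (b b' : n) : TensorRel M N (sNM F b a * sNM F b' a')
      (sMN F (M.left (N.hom b) a) (N.right b' (M.hom a')))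
  | r5b₂ (a a' : m) (b b' : n) : TensorRel M N (sNM F b a * sNM F b' a')
      (sNM F (N.right b (M.hom a)) (M.left (N.hom b') a'))
  | r5c₁ (a a' : m) (b b' : n) : TensorRel M N (sMN F a b * sNM F b' a')
      (sMN F (M.right a (N.hom b)) (N.right b' (M.hom a')))
  | r5c₂ (a a' : m) (b b' : n) : TensorRel M N (sMN F a b * sNM F b' a')
      (sNM F (N.left (M.hom a) b) (M.left (N.hom b') a'))
  | r5d₁ (a a' : m) (b b' : n) : TensorRel M N (sNM F b a * sMN F a' b')
      (sMN F (M.left (N.hom b) a) (N.left (M.hom a') b'))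
  | r5d₂ (a a' : m) (b b' : n) : TensorRel M N (sNM F b a * sMN F a' b')
      (sNM F (N.right b (M.hom a)) (M.right a' (N.hom b')))

/-- The set of differences of the two sides of the defining relations. -/
def tensorRels (M : CrossedModule F m g) (N : CrossedModule F n g) : Set (TensorFree F m n) :=
  {r | ∃ p q, TensorRel M N p q ∧ r = p - q}

/-- The non-abelian tensor product `m ∗ n` of the crossed modules `M : m → g`, `N : n → g`. -/
noncomputable abbrev Tensor (M : CrossedModule F m g) (N : CrossedModule F n g) := Presented (tensorRels M N)

/-- The element `a ∗ b`, `a ∈ m`, `b ∈ n`. -/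
noncomputable def tMN (M : CrossedModule F m g) (N : CrossedModule F n g) (a : m) (b : n) : Tensor M N :=
  Presented.gen _ (Sum.inl (a, b))

/-- The element `b ∗ a`, `b ∈ n`, `a ∈ m`. -/
noncomputable def tNM (M : CrossedModule F m g) (N : CrossedModule F n g) (b : n) (a : m) : Tensor M N :=
  Presented.gen _ (Sum.inr (b, a))

theorem Tensor.rel {M : CrossedModule F m g} {N : CrossedModule F n g} {p q : TensorFree F m n}
    (hpq : TensorRel M N p q) :
    Presented.mk (tensorRels M N) p = Presented.mk (tensorRels M N) q :=
  (Submodule.Quotient.eq _).2 (subset_presIdeal _ ⟨p, q, hpq, rfl⟩)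

/-- The subspace `m □ n` of `m ∗ n`, spanned by the elements `a ∗ b' - b ∗ a'` with
`M.hom a = N.hom b` and `M.hom a' = N.hom b'`. -/
noncomputable def squareSpan (M : CrossedModule F m g) (N : CrossedModule F n g) : Submodule F (Tensor M N) :=
  Submodule.span F {t | ∃ (a a' : m) (b b' : n), M.hom a = N.hom b ∧ M.hom a' = N.hom b' ∧
    t = tMN M N a b' - tNM M N b a'}

theorem squareSpan_central (M : CrossedModule F m g) (N : CrossedModule F n g)
    (t : Tensor M N) (ht : t ∈ squareSpan M N) (y : Tensor M N) :
    br F t y = 0 ∧ br F y t = 0 := by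
  induction ht using Submodule.span_induction with
  | zero => simp [br]
  | add p q _ _ hp hq =>
    simp only [br] at hp hq ⊢
    simp [hp.1, hp.2, hq.1, hq.2]
  | smul c p _ hp =>
    simp only [br] at hp ⊢
    simp [hp.1, hp.2]
  | mem t ht =>
    obtain ⟨a, a', b, b', h1, h2, rfl⟩ := ht
    have sub_l : ∀ x y z : Tensor M N, br F (x - y) z = br F x z - br F y z := by
      intro x y z; simp [br]
    have sub_r : ∀ x y z : Tensor M N, br F z (x - y) = br F z x - br F z y := by
      intro x y z; simp [br]
    have key : N.left (M.hom a) b' = N.right b (M.hom a') := by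
      rw [h1, h2, N.left_hom, N.right_hom]
    have key' : M.right a (N.hom b') = M.left (N.hom b) a' := by
      rw [← h1, ← h2, M.left_hom, M.right_hom]
    apply Presented.central_of_gen
    rintro (⟨p, q⟩ | ⟨q, p⟩)
    · rw [sub_l, sub_r, sub_eq_zero, sub_eq_zero]
      refine ⟨?_, ?_⟩
      · exact (Tensor.rel (.r5a₁ a p b' q)).trans
          (by rw [key']; exact (Tensor.rel (.r5d₁ a' p b q)).symm)
      · exact (Tensor.rel (.r5a₂ p a q b')).trans
          (by rw [key']; exact (Tensor.rel (.r5c₂ p a' q b)).symm)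
    · rw [sub_l, sub_r, sub_eq_zero, sub_eq_zero]
      refine ⟨?_, ?_⟩
      · exact (Tensor.rel (.r5c₁ a p b' q)).trans
          (by rw [key']; exact (Tensor.rel (.r5b₁ a' p b q)).symm)
      · exact (Tensor.rel (.r5d₂ p a q b')).trans
          (by rw [key']; exact (Tensor.rel (.r5b₂ p a' q b)).symm)

/-- `m □ n` as an ideal (it is central). -/
noncomputable def square (M : CrossedModule F m g) (N : CrossedModule F n g) : Ideal F (Tensor M N) where
  toSubmodule := squareSpan M N
  br_left_mem x a ha := by
    have := (squareSpan_central M N a ha x).2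
    rw [this]
    exact (squareSpan M N).zero_mem
  br_right_mem := fun {a} x ha => by
    have := (squareSpan_central M N a ha x).1
    rw [this]
    exact (squareSpan M N).zero_mem

/-- The non-abelian exterior product `m ⋏ n = (m ∗ n) / (m □ n)`. -/
abbrev Exterior (M : CrossedModule F m g) (N : CrossedModule F n g) :=
  Quo (square M N)

/-- The element `a ⋏ b`, `a ∈ m`, `b ∈ n`. -/
noncomputable def eMN (M : CrossedModule F m g) (N : CrossedModule F n g) (a : m) (b : n) : Exterior M N :=
  (square M N).proj (tMN M N a b)

/-- The element `b ⋏ a`, `b ∈ n`, `a ∈ m`. -/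
noncomputable def eNM (M : CrossedModule F m g) (N : CrossedModule F n g) (b : n) (a : m) : Exterior M N :=
  (square M N).proj (tNM M N b a)

end Tensor

section Homology

variable (F : Type u) (g : Type v) {h : Type w} [Field F]
  [AddCommGroup g] [Module F g] [LeibnizAlgebra F g]
  [AddCommGroup h] [Module F h] [LeibnizAlgebra F h]

/-- Leibniz chains `CL_n(g) = g^{⊗ n}`. -/
abbrev CL (n : ℕ) := PiTensorProduct F (fun _ : Fin n => g)

variable {g}

/-- The multilinear map sending `(x_t)_t` to the pure tensor obtained by deleting `x_j` and
replacing the entry which is then in position `i` by its bracket with `x_j`. -/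
def boundaryTerm (n : ℕ) (j : Fin (n + 1)) (i : Fin n) :
    MultilinearMap F (fun _ : Fin (n + 1) => g) (CL F g n) where
  toFun x := PiTensorProduct.tprod F
    (Function.update (j.removeNth x) i (br F (x (j.succAbove i)) (x j)))
  map_update_add' := by
    intro inst x t a b
    obtain rfl : inst = instDecidableEqFin (n + 1) := Subsingleton.elim _ _
    obtain rfl | ⟨s, rfl⟩ := Fin.eq_self_or_eq_succAbove j t
    · simp [Fin.removeNth_update, br]
    · have e : ∀ v, Function.update x (j.succAbove s) v j = x j := fun v =>
        Function.update_of_ne (Fin.succAbove_ne j s).symm v x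
      simp only [Fin.removeNth_update_succAbove, e]
      by_cases hs : s = i
      · subst hs
        simp [br]
      · have hs' : j.succAbove i ≠ j.succAbove s := fun e =>
          hs (Fin.succAbove_right_injective e).symm
        have e' : ∀ v, Function.update x (j.succAbove s) v (j.succAbove i) = x (j.succAbove i) :=
          fun v => Function.update_of_ne hs' v x
        simp only [e']
        rw [Function.update_comm hs, Function.update_comm hs, Function.update_comm hs]
        simp
  map_update_smul' := by
    intro inst x t c a
    obtain rfl : inst = instDecidableEqFin (n + 1) := Subsingleton.elim _ _
    obtain rfl | ⟨s, rfl⟩ := Fin.eq_self_or_eq_succAbove j t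
    · simp [Fin.removeNth_update, br]
    · have e : ∀ v, Function.update x (j.succAbove s) v j = x j := fun v =>
        Function.update_of_ne (Fin.succAbove_ne j s).symm v x
      simp only [Fin.removeNth_update_succAbove, e]
      by_cases hs : s = i
      · subst hs
        simp [br]
      · have hs' : j.succAbove i ≠ j.succAbove s := fun e =>
          hs (Fin.succAbove_right_injective e).symm
        have e' : ∀ v, Function.update x (j.succAbove s) v (j.succAbove i) = x (j.succAbove i) :=
          fun v => Function.update_of_ne hs' v x
        simp only [e']
        rw [Function.update_comm hs, Function.update_comm hs]
        simp

variable (g)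

/-- The Leibniz boundary `∂_{n+1} : CL_{n+1}(g) → CL_n(g)`,
`∂(x_1 ⊗ ⋯ ⊗ x_{n+1}) = ∑_{i < j} (-1)^j x_1 ⊗ ⋯ ⊗ [x_i, x_j] ⊗ ⋯ ⊗ x̂_j ⊗ ⋯ ⊗ x_{n+1}`.
Here indices start at `0`, so the sign is `(-1)^(j+1)`; as `i < j`, deleting `x_j` leaves `x_i`
in position `i`. -/
noncomputable def boundary (n : ℕ) : CL F g (n + 1) →ₗ[F] CL F g n :=
  PiTensorProduct.lift
    (∑ j : Fin (n + 1), ∑ i : Fin n,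
      if i.castSucc < j then (-1 : F) ^ ((j : ℕ) + 1) • boundaryTerm F n j i else 0)

theorem boundary_tprod (n : ℕ) (x : Fin (n + 1) → g) :
    boundary F g n (PiTensorProduct.tprod F x) =
      ∑ j : Fin (n + 1), ∑ i : Fin n,
        if i.castSucc < j then (-1 : F) ^ ((j : ℕ) + 1) • PiTensorProduct.tprod F
          (Function.update (j.removeNth x) i (br F (x (j.succAbove i)) (x j))) else 0 := by
  rw [boundary, PiTensorProduct.lift.tprod, sum_apply]
  refine Finset.sum_congr rfl fun j _ => ?_
  rw [sum_apply]
  refine Finset.sum_congr rfl fun i _ => ?_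
  split_ifs <;> rfl

variable {F g}

/-- The map `CL_n(g) → CL_n(h)` induced by a linear map `g → h`. -/
noncomputable def CLmap (f : g →ₗ[F] h) (n : ℕ) : CL F g n →ₗ[F] CL F h n :=
  PiTensorProduct.map (fun _ => f)

/-- `CLmap` is a chain map. -/
theorem boundary_CLmap (f : Hom F g h) (n : ℕ) (u : CL F g (n + 1)) :
    boundary F h n (CLmap f.toLinearMap (n + 1) u) =
      CLmap f.toLinearMap n (boundary F g n u) := by
  have : (boundary F h n) ∘ₗ (CLmap f.toLinearMap (n + 1)) =
      (CLmap f.toLinearMap n) ∘ₗ (boundary F g n) := by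
    apply PiTensorProduct.ext
    refine MultilinearMap.ext fun x => ?_
    simp only [CLmap, LinearMap.compMultilinearMap_apply, LinearMap.comp_apply,
      PiTensorProduct.map_tprod]
    rw [boundary_tprod, boundary_tprod, map_sum]
    refine Finset.sum_congr rfl fun j _ => ?_
    rw [map_sum]
    refine Finset.sum_congr rfl fun i _ => ?_
    split_ifs with hij
    · rw [map_smul, PiTensorProduct.map_tprod]
      congr 2
      funext t
      by_cases ht : t = i
      · subst ht
        simpa using (f.map_br (x (j.succAbove t)) (x j)).symm
      · simp [Function.update_of_ne ht, Fin.removeNth]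
    · simp
  exact LinearMap.congr_fun this u

/-- `M_{n+1} = CL_n(g) ⊕ CL_{n+1}(g/I)`, the degree `n + 1` part of the mapping cone of
`CL_*(g) → CL_*(g/I)`. -/
abbrev Cone (I : Ideal F g) (n : ℕ) := CL F g n × CL F (Quo I) (n + 1)

/-- The differential `δ_{n+2} : M_{n+2} → M_{n+1}` of the mapping cone,
`δ(a, b) = (-∂ a, ∂ b + π a)`. -/
noncomputable def coneD (I : Ideal F g) (n : ℕ) : Cone I (n + 1) →ₗ[F] Cone I n :=
  LinearMap.prod
    (-(boundary F g n ∘ₗ LinearMap.fst F _ _))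
    (boundary F (Quo I) (n + 1) ∘ₗ LinearMap.snd F _ _ +
      CLmap I.proj.toLinearMap (n + 1) ∘ₗ LinearMap.fst F _ _)

/-- The relative Leibniz homology `HL_{n+1}(g, I) = H_{n+2}(M_*)` (in positive degrees). -/
def RelHL (I : Ideal F g) (n : ℕ) : Type (max u v) :=
  LinearMap.ker (coneD I n) ⧸
    (LinearMap.range (coneD I (n + 1))).submoduleOf (LinearMap.ker (coneD I n))

noncomputable instance (I : Ideal F g) (n : ℕ) : AddCommGroup (RelHL I n) :=
  inferInstanceAs (AddCommGroup (LinearMap.ker (coneD I n) ⧸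
    (LinearMap.range (coneD I (n + 1))).submoduleOf (LinearMap.ker (coneD I n))))

noncomputable instance (I : Ideal F g) (n : ℕ) : Module F (RelHL I n) :=
  inferInstanceAs (Module F (LinearMap.ker (coneD I n) ⧸
    (LinearMap.range (coneD I (n + 1))).submoduleOf (LinearMap.ker (coneD I n))))

/-- Homology is regarded as an abelian Leibniz algebra. -/
noncomputable instance (I : Ideal F g) (n : ℕ) : LeibnizAlgebra F (RelHL I n) where
  bracket := 0
  leibniz _ _ _ := by simp

/-- The class of a cycle. -/
noncomputable def RelHL.mk (I : Ideal F g) (n : ℕ) : LinearMap.ker (coneD I n) →ₗ[F] RelHL I n :=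
  Submodule.mkQ _

/-- `z` is a cycle whose homology class is `c`. -/
def Represents {I : Ideal F g} {n : ℕ} (z : Cone I (n + 1)) (c : RelHL I n) : Prop :=
  ∃ hz : z ∈ LinearMap.ker (coneD I n), RelHL.mk I n ⟨z, hz⟩ = c

/-- The homomorphism `g / I → h / J` induced by `f : g → h` with `f(I) ⊆ J`. -/
def quotMap (f : Hom F g h) {I : Ideal F g} {J : Ideal F h}
    (hf : ∀ x ∈ I.toSubmodule, f x ∈ J.toSubmodule) :
    Hom F (Quo I) (Quo J) where
  toLinearMap := I.toSubmodule.mapQ J.toSubmodule f.toLinearMap hf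
  map_br x y := by
    obtain ⟨x, rfl⟩ := Submodule.Quotient.mk_surjective _ x
    obtain ⟨y, rfl⟩ := Submodule.Quotient.mk_surjective _ y
    exact congrArg (Submodule.Quotient.mk (p := J.toSubmodule)) (f.map_br x y)

/-- The map of mapping cones induced by `f : g → h` with `f(I) ⊆ J`. -/
noncomputable def coneMap (f : Hom F g h) {I : Ideal F g} {J : Ideal F h}
    (hf : ∀ x ∈ I.toSubmodule, f x ∈ J.toSubmodule) (n : ℕ) : Cone I n →ₗ[F] Cone J n :=
  LinearMap.prodMap (CLmap f.toLinearMap n) (CLmap (quotMap f hf).toLinearMap (n + 1))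

theorem coneD_coneMap (f : Hom F g h) {I : Ideal F g} {J : Ideal F h}
    (hf : ∀ x ∈ I.toSubmodule, f x ∈ J.toSubmodule) (n : ℕ) (z : Cone I (n + 1)) :
    coneD J n (coneMap f hf (n + 1) z) = coneMap f hf n (coneD I n z) := by
  obtain ⟨a, b⟩ := z
  have hcomm : CLmap J.proj.toLinearMap (n + 1) (CLmap f.toLinearMap (n + 1) a) =
      CLmap (quotMap f hf).toLinearMap (n + 1) (CLmap I.proj.toLinearMap (n + 1) a) := by
    simp only [CLmap, ← LinearMap.comp_apply, ← PiTensorProduct.map_comp]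
    rfl
  refine Prod.ext ?_ ?_
  · simp [coneD, coneMap, boundary_CLmap]
  · simp [coneD, coneMap, boundary_CLmap, hcomm]

/-- The homomorphism `HL_{n+1}(g, I) → HL_{n+1}(h, J)` induced by `f : g → h` with
`f(I) ⊆ J`. -/
noncomputable def RelHL.map (f : Hom F g h) {I : Ideal F g} {J : Ideal F h}
    (hf : ∀ x ∈ I.toSubmodule, f x ∈ J.toSubmodule) (n : ℕ) :
    Hom F (RelHL I n) (RelHL J n) where
  toLinearMap := Submodule.mapQ _ _
    ((coneMap f hf (n + 1)).restrict (p := LinearMap.ker (coneD I n))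
      (q := LinearMap.ker (coneD J n)) (fun z hz => by
        rw [LinearMap.mem_ker] at hz ⊢
        rw [coneD_coneMap, hz, map_zero]))
    (by
      rintro ⟨z, hz⟩ ⟨y, hy⟩
      exact ⟨coneMap f hf (n + 2) y, by rw [coneD_coneMap, hy]; rfl⟩)
  map_br x y := by
    show (Submodule.mapQ _ _ _ _ : _ →ₗ[F] _) 0 = 0
    exact map_zero _

/-- The second relative homology `HL_2(g, I)`. -/
abbrev HL₂ (I : Ideal F g) := RelHL I 1

/-- The natural map `HL_2(g, n) → HL_2(g/k, n/k)`. -/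
noncomputable def HL₂proj (n k : Ideal F g) : Hom F (HL₂ n) (HL₂ (n.quot k)) :=
  RelHL.map k.proj (I := n) (J := n.quot k) (fun x hx => ⟨x, hx, rfl⟩) 1

end Homology

end Leib

/-! Since `CL_*(g) → CL_*(g/n)` is onto, its mapping cone computes, up to a degree shift, the
homology of its kernel K(g, n), so HL_2(g, n) = H_2(K(g, n)). For k ⊆ n the complexes form a short
exact sequence 0 → K(g, k) → K(g, n) → K(g/k, n/k) → 0, whose long exact sequence reads H_2(K(g, k))
→ HL_2(g, n) → HL_2(g/k, n/k) → H_1(K(g, k)) → H_1(K(g, n)). The last two terms are k/[g, k] and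
n/[g, n]. As k is central the former is k, and the kernel of k → n/[g, n] is [g, n] ∩ k.

It remains to replace H_2(K(g, k)) by g ⋏ k. The degree-two part of K(g, k) is spanned by the
tensors x ⊗ a and a ⊗ x with a ∈ k (`ker_CLmap_two`), and centrality makes all of them cycles
(`boundary_eq_zero_of_central`). So any α with the prescribed values on generators hits every class
coming from K(g, k). Such an α exists because g and k act trivially on each other: the defining
relations then ask only for bilinearity and for killing [g, g] ⋏ k, k ⋏ [g, g] and products
(`exists_exterior_lift`). The tensors [x, y] ⊗ a and a ⊗ [x, y] are boundaries up to sign, of x ⊗ y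
⊗ a and a ⊗ x ⊗ y.

The diagram chase is done on chains: `exists_represents` and `represents_zero_iff` pass from the
cone to the kernel, while `exists_lift` and `exists_boundary_add` lift from g/k to g. -/

namespace Leib

universe u v w

/-! ### Leibniz chains in low degrees -/

section Chains

variable {F : Type u} {g : Type v} {h : Type w} [Field F]
  [AddCommGroup g] [Module F g] [LeibnizAlgebra F g]
  [AddCommGroup h] [Module F h] [LeibnizAlgebra F h]

/-- The bilinear map `(x, y) ↦ x ⊗ y` into `CL_2(g)`. -/
noncomputable def pure₂ : g →ₗ[F] g →ₗ[F] CL F g 2 :=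
  LinearMap.mk₂ F (fun x y => PiTensorProduct.tprod F ![x, y])
    (fun a b y => (PiTensorProduct.tprod F (s := fun _ : Fin 2 => g)).cons_add ![y] a b)
    (fun c a y => (PiTensorProduct.tprod F (s := fun _ : Fin 2 => g)).cons_smul ![y] c a)
    (fun x a b => ((PiTensorProduct.tprod F (s := fun _ : Fin 2 => g)).curryLeft x).cons_add ![] a b)
    (fun c x a => ((PiTensorProduct.tprod F (s := fun _ : Fin 2 => g)).curryLeft x).cons_smul ![] c a)

omit [LeibnizAlgebra F g] in
theorem pure₂_apply (x y : g) : pure₂ (F := F) x y = PiTensorProduct.tprod F ![x, y] := rfl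

/-- The identification of `g` with `CL_1(g)`. -/
noncomputable def pure₁ : g ≃ₗ[F] CL F g 1 :=
  (PiTensorProduct.subsingletonEquiv (s := fun _ : Fin 1 => g) (0 : Fin 1)).symm

omit [LeibnizAlgebra F g] in
theorem pure₁_apply (x : g) : pure₁ (F := F) x = PiTensorProduct.tprod F (fun _ => x) := by
  rw [pure₁, LinearEquiv.symm_apply_eq]
  simp

omit [LeibnizAlgebra F g] in
theorem tprod_two (x : Fin 2 → g) : PiTensorProduct.tprod F x = pure₂ (x 0) (x 1) := by
  rw [pure₂_apply]
  congr 1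
  ext i
  fin_cases i <;> rfl

theorem boundary_pure₂ (x y : g) : boundary F g 1 (pure₂ x y) = pure₁ (br F x y) := by
  rw [pure₂_apply, boundary_tprod, pure₁_apply]
  simp [Fin.sum_univ_succ]
  congr 1
  ext i
  fin_cases i
  simp


theorem boundary_three (x : Fin (2 + 1) → g) :
    boundary F g 2 (PiTensorProduct.tprod F x) =
      pure₂ (br F (x 0) (x 1)) (x 2) - pure₂ (br F (x 0) (x 2)) (x 1)
        - pure₂ (x 0) (br F (x 1) (x 2)) := by
  rw [boundary_tprod]
  simp only [Fin.sum_univ_succ, tprod_two]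
  have h3 : (-1 : F) ^ 3 = -1 := by norm_num
  simp [Fin.removeNth, Fin.succAbove, h3]
  abel

theorem boundary_boundary_two (v : CL F g 3) : boundary F g 1 (boundary F g 2 v) = 0 := by
  have : boundary F g 1 ∘ₗ boundary F g 2 = 0 := by
    apply PiTensorProduct.ext
    refine MultilinearMap.ext fun x => ?_
    obtain ⟨d, hd⟩ : ∃ d : CL F g 2 →ₗ[F] CL F g 1, d = boundary F g 1 := ⟨_, rfl⟩
    have hd₂ (x y : g) : d (pure₂ x y) = pure₁ (br F x y) := by rw [hd, boundary_pure₂]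
    rw [LinearMap.compMultilinearMap_apply, LinearMap.comp_apply, boundary_three]
    refine (LinearMap.congr_fun hd _).symm.trans (?_ : d _ = 0)
    simp only [map_sub, hd₂, br_leibniz]
    abel
  exact LinearMap.congr_fun this v

theorem boundary_boundary_three (v : CL F g 4) : boundary F g 2 (boundary F g 3 v) = 0 := by
  have : boundary F g 2 ∘ₗ boundary F g 3 = 0 := by
    apply PiTensorProduct.ext
    refine MultilinearMap.ext fun x => ?_
    obtain ⟨d, hd⟩ : ∃ d : CL F g 3 →ₗ[F] CL F g 2, d = boundary F g 2 := ⟨_, rfl⟩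
    have hd₃ (x : Fin 3 → g) : d (PiTensorProduct.tprod F x) =
        pure₂ (br F (x 0) (x 1)) (x 2) - pure₂ (br F (x 0) (x 2)) (x 1)
          - pure₂ (x 0) (br F (x 1) (x 2)) := by rw [hd, boundary_three]
    have h3 : (-1 : F) ^ 3 = -1 := by norm_num
    have h4 : (-1 : F) ^ 4 = 1 := by norm_num
    rw [LinearMap.compMultilinearMap_apply, LinearMap.comp_apply, boundary_tprod]
    refine (LinearMap.congr_fun hd _).symm.trans (?_ : d _ = 0)
    simp [Fin.sum_univ_succ, Fin.removeNth, Fin.succAbove, h3, h4, hd₃, -Fin.val_fin_lt]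
    simp only [br_leibniz, map_sub, LinearMap.sub_apply]
    abel
  exact LinearMap.congr_fun this v

omit [LeibnizAlgebra F g] [LeibnizAlgebra F h] in
theorem CLmap_pure₁ (f : g →ₗ[F] h) (x : g) : CLmap f 1 (pure₁ x) = pure₁ (f x) := by
  simp [pure₁_apply, CLmap]

omit [LeibnizAlgebra F g] [LeibnizAlgebra F h] in
theorem CLmap_pure₂ (f : g →ₗ[F] h) (x y : g) : CLmap f 2 (pure₂ x y) = pure₂ (f x) (f y) := by
  rw [pure₂_apply, CLmap, PiTensorProduct.map_tprod, tprod_two]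
  rfl

omit [LeibnizAlgebra F g] [LeibnizAlgebra F h] in
-- Over a field f has a linear section, and functoriality of tensor powers turns it into a section
-- of `CLmap f m`.
theorem CLmap_surjective (f : g →ₗ[F] h) (hf : Function.Surjective f) (m : ℕ) :
    Function.Surjective (CLmap f m) := by
  obtain ⟨s, hs⟩ := f.exists_rightInverse_of_surjective (LinearMap.range_eq_top.2 hf)
  intro u
  refine ⟨CLmap s m u, ?_⟩
  rw [CLmap, CLmap, ← LinearMap.comp_apply, ← PiTensorProduct.map_comp, hs]
  simp

omit [LeibnizAlgebra F g] in
/-- `CL_2(g)` is spanned by pure tensors. -/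
theorem CL_two_induction {p : CL F g 2 → Prop} (u : CL F g 2)
    (tmul : ∀ x y, p (pure₂ x y)) (add : ∀ a b, p a → p b → p (a + b)) : p u := by
  induction u using PiTensorProduct.induction_on with
  | smul_tprod r x =>
    -- The scalar is absorbed into the first factor, so the induction needs no scalar case.
    rw [tprod_two, ← LinearMap.smul_apply, ← map_smul]
    exact tmul _ _
  | add a b ha hb => exact add a b ha hb

/-- The span of the tensors `x ⊗ a` and `a ⊗ x` with `x ∈ g` and `a ∈ I`. -/
def mixedSpan (I : Submodule F g) : Submodule F (CL F g 2) :=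
  Submodule.span F {t | ∃ x : g, ∃ a ∈ I, t = pure₂ x a ∨ t = pure₂ a x}

omit [LeibnizAlgebra F g] [LeibnizAlgebra F h] in
-- With a linear section s of f, replacing x ⊗ y by sf(x) ⊗ sf(y) one factor at a time changes it
-- only by tensors with an entry in ker f. On the kernel of `CLmap f 2` the replaced chain is zero.
theorem ker_CLmap_two (f : g →ₗ[F] h) (hf : Function.Surjective f) :
    LinearMap.ker (CLmap f 2) = mixedSpan (LinearMap.ker f) := by
  refine le_antisymm (fun u hu => ?_) ?_
  · obtain ⟨s, hs⟩ := f.exists_rightInverse_of_surjective (LinearMap.range_eq_top.2 hf)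
    have hs' (x : g) : x - s (f x) ∈ LinearMap.ker f := by
      rw [LinearMap.mem_ker, map_sub, ← LinearMap.comp_apply f s, hs, LinearMap.id_apply, sub_self]
    have key (u : CL F g 2) : u - CLmap s 2 (CLmap f 2 u) ∈ mixedSpan (LinearMap.ker f) := by
      induction u using CL_two_induction with
      | tmul x y =>
        have e : pure₂ (F := F) x y - pure₂ (s (f x)) (s (f y)) =
            pure₂ (x - s (f x)) y + pure₂ (s (f x)) (y - s (f y)) := by
          simp
        rw [CLmap_pure₂, CLmap_pure₂, e]
        exact add_mem (Submodule.subset_span ⟨y, _, hs' x, Or.inr rfl⟩)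
          (Submodule.subset_span ⟨s (f x), _, hs' y, Or.inl rfl⟩)
      | add a b ha hb =>
        rw [map_add, map_add, add_sub_add_comm]
        exact add_mem ha hb
    have := key u
    rwa [LinearMap.mem_ker.1 hu, map_zero, sub_zero] at this
  · rw [mixedSpan, Submodule.span_le]
    rintro _ ⟨x, a, ha, rfl | rfl⟩
    · simp [CLmap_pure₂, LinearMap.mem_ker.1 ha]
    · simp [CLmap_pure₂, LinearMap.mem_ker.1 ha]

theorem CLmap_proj_two_eq_zero (I : Ideal F g) (u : CL F g 2) :
    CLmap I.proj.toLinearMap 2 u = 0 ↔ u ∈ mixedSpan I.toSubmodule := by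
  rw [← LinearMap.mem_ker, ker_CLmap_two _ I.proj_surjective]
  have : LinearMap.ker I.proj.toLinearMap = I.toSubmodule := Submodule.ker_mkQ _
  rw [this]

/-- The boundaries of the kernel of `CL_2(g) → CL_2(g/I)` make up `[g, I]`. -/
theorem map_boundary_mixedSpan (I : Ideal F g) :
    (mixedSpan I.toSubmodule).map (boundary F g 1) =
      (commutator I).toSubmodule.map (pure₁ (F := F) (g := g)).toLinearMap := by
  change _ = (Submodule.span F _).map _
  rw [mixedSpan, Submodule.map_span, Submodule.map_span]
  congr 1
  ext z
  constructor
  · rintro ⟨_, ⟨x, a, ha, rfl | rfl⟩, rfl⟩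
    · exact ⟨_, ⟨x, a, ha, Or.inl rfl⟩, (boundary_pure₂ x a).symm⟩
    · exact ⟨_, ⟨x, a, ha, Or.inr rfl⟩, (boundary_pure₂ a x).symm⟩
  · rintro ⟨_, ⟨x, a, ha, rfl | rfl⟩, rfl⟩
    · exact ⟨_, ⟨x, a, ha, Or.inl rfl⟩, boundary_pure₂ x a⟩
    · exact ⟨_, ⟨x, a, ha, Or.inr rfl⟩, boundary_pure₂ a x⟩

/-- Each spanning tensor x ⊗ a or a ⊗ x has boundary a bracket with a ∈ k, which vanishes. This
makes the connecting map independent of the lift. -/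
theorem boundary_eq_zero_of_central {k : Ideal F g}
    (hk : ∀ a ∈ k.toSubmodule, ∀ x, br F x a = 0 ∧ br F a x = 0) {u : CL F g 2}
    (hu : CLmap k.proj.toLinearMap 2 u = 0) : boundary F g 1 u = 0 := by
  rw [CLmap_proj_two_eq_zero] at hu
  refine (Submodule.span_le (p := LinearMap.ker (boundary F g 1))).2 ?_ hu
  rintro _ ⟨x, a, ha, rfl | rfl⟩
  · simp [boundary_pure₂, (hk a ha x).1]
  · simp [boundary_pure₂, (hk a ha x).2]

end Chains

/-! ### Relative homology through the kernel complex -/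

section RelativeCycles

variable {F : Type u} {g : Type v} [Field F] [AddCommGroup g] [Module F g] [LeibnizAlgebra F g]

theorem coneD_mk (I : Ideal F g) (m : ℕ) (a : CL F g (m + 1)) (b : CL F (Quo I) (m + 2)) :
    coneD I m (a, b) =
      (-boundary F g m a, boundary F (Quo I) (m + 1) b + CLmap I.proj.toLinearMap (m + 1) a) := rfl

theorem mem_ker_coneD {I : Ideal F g} {u : CL F g 2} (hu : CLmap I.proj.toLinearMap 2 u = 0)
    (hd : boundary F g 1 u = 0) : ((u, 0) : Cone I 2) ∈ LinearMap.ker (coneD I 1) := by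
  rw [LinearMap.mem_ker, coneD_mk, hd, hu]
  simp

theorem Represents.boundary_eq_zero {I : Ideal F g} {u : CL F g 2} {b : CL F (Quo I) 3}
    {c : HL₂ I} (h : Represents (I := I) (n := 1) (u, b) c) : boundary F g 1 u = 0 := by
  obtain ⟨h, -⟩ := h
  rw [LinearMap.mem_ker, coneD_mk] at h
  exact neg_eq_zero.1 (congrArg Prod.fst h)

theorem Represents.unique {I : Ideal F g} {z : Cone I 2} {c c' : HL₂ I}
    (h : Represents (n := 1) z c) (h' : Represents (n := 1) z c') : c = c' := by
  obtain ⟨_, rfl⟩ := h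
  obtain ⟨_, rfl⟩ := h'
  rfl

theorem Represents.add {I : Ideal F g} {u u' : CL F g 2} {c c' : HL₂ I}
    (h : Represents (I := I) (n := 1) (u, 0) c) (h' : Represents (I := I) (n := 1) (u', 0) c') :
    Represents (I := I) (n := 1) (u + u', 0) (c + c') := by
  obtain ⟨h, rfl⟩ := h
  obtain ⟨h', rfl⟩ := h'
  rw [← map_add]
  have e : ((u + u', 0) : Cone I 2) = (u, 0) + (u', 0) := by simp
  exact ⟨e ▸ add_mem h h', congrArg _ (Subtype.ext e)⟩

theorem Represents.smul {I : Ideal F g} {u : CL F g 2} {c : HL₂ I} (r : F)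
    (h : Represents (I := I) (n := 1) (u, 0) c) :
    Represents (I := I) (n := 1) (r • u, 0) (r • c) := by
  obtain ⟨h, rfl⟩ := h
  rw [← map_smul]
  have e : ((r • u, 0) : Cone I 2) = r • (u, 0) := by simp
  exact ⟨e ▸ Submodule.smul_mem _ r h, congrArg _ (Subtype.ext e)⟩

theorem Represents.sub {I : Ideal F g} {u u' : CL F g 2} {c c' : HL₂ I}
    (h : Represents (I := I) (n := 1) (u, 0) c) (h' : Represents (I := I) (n := 1) (u', 0) c') :
    Represents (I := I) (n := 1) (u - u', 0) (c - c') := by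
  simpa [sub_eq_add_neg] using h.add (h'.smul (-1))

/-- Every class in `HL_2(g, I)` is represented by a cycle of the kernel of
`CL_*(g) → CL_*(g/I)`. -/
theorem exists_represents {I : Ideal F g} (c : HL₂ I) :
    ∃ u : CL F g 2, CLmap I.proj.toLinearMap 2 u = 0 ∧ Represents (I := I) (n := 1) (u, 0) c := by
  obtain ⟨⟨⟨a, b⟩, hz⟩, rfl⟩ := Submodule.mkQ_surjective _ c
  obtain ⟨w, rfl⟩ := CLmap_surjective _ I.proj_surjective 3 b
  have h := LinearMap.mem_ker.1 hz
  rw [coneD_mk] at h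
  have h₁ : boundary F g 1 a = 0 := neg_eq_zero.1 (congrArg Prod.fst h)
  have h₂ := congrArg Prod.snd h
  have hu : CLmap I.proj.toLinearMap 2 (a + boundary F g 2 w) = 0 := by
    rw [map_add, ← boundary_CLmap, add_comm]
    exact h₂
  have hd : boundary F g 1 (a + boundary F g 2 w) = 0 := by
    rw [map_add, h₁, boundary_boundary_two, add_zero]
  refine ⟨_, hu, mem_ker_coneD hu hd, (Submodule.Quotient.eq _).2 ?_⟩
  -- If w lifts b, then δ(-w, 0) = (∂w, -b), which is exactly (a + ∂w, 0) - (a, b).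
  refine ⟨(-w, 0), ?_⟩
  rw [coneD_mk]
  ext1 <;> simp

/-- A cycle of the kernel of `CL_*(g) → CL_*(g/I)` is a boundary in the mapping cone if and only
if it is a boundary in the kernel. -/
theorem represents_zero_iff {I : Ideal F g} {u : CL F g 2}
    (hu : CLmap I.proj.toLinearMap 2 u = 0) :
    Represents (I := I) (n := 1) (u, 0) 0 ↔
      ∃ v : CL F g 3, CLmap I.proj.toLinearMap 3 v = 0 ∧ boundary F g 2 v = u := by
  constructor
  · rintro ⟨hz, h⟩
    obtain ⟨⟨a, b⟩, hab⟩ := (Submodule.Quotient.mk_eq_zero _).1 h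
    obtain ⟨w, rfl⟩ := CLmap_surjective _ I.proj_surjective 4 b
    rw [coneD_mk] at hab
    have h₁ := congrArg Prod.fst hab
    have h₂ := congrArg Prod.snd hab
    -- From (u, 0) = δ(a, πw) one gets u = -∂a and π(a + ∂w) = 0. Adding ∂w moves a into the kernel
    -- without changing its boundary.
    refine ⟨-(a + boundary F g 3 w), ?_, ?_⟩
    · rw [map_neg, map_add, ← boundary_CLmap, add_comm, neg_eq_zero]
      exact h₂
    · rw [map_neg, map_add, boundary_boundary_three, add_zero]
      exact h₁
  · rintro ⟨v, hv, rfl⟩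
    refine ⟨mem_ker_coneD hu (boundary_boundary_two v), (Submodule.Quotient.mk_eq_zero _).2 ?_⟩
    refine ⟨(-v, 0), ?_⟩
    rw [coneD_mk]
    ext1 <;> simp [hv]

theorem Ideal.proj_mem_quot {n : Ideal F g} (k : Ideal F g) (x : g) (hx : x ∈ n.toSubmodule) :
    k.proj x ∈ (n.quot k).toSubmodule := ⟨x, hx, rfl⟩

theorem Represents.map {n k : Ideal F g} {u : CL F g 2} {c : HL₂ n}
    (h : Represents (I := n) (n := 1) (u, 0) c) :
    Represents (I := n.quot k) (n := 1) (CLmap k.proj.toLinearMap 2 u, 0) (HL₂proj n k c) := by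
  obtain ⟨h, rfl⟩ := h
  have e : coneMap k.proj (k.proj_mem_quot (n := n)) 2 (u, 0) =
      (CLmap k.proj.toLinearMap 2 u, 0) := by
    simp [coneMap]
  have hz : coneD (n.quot k) 1 (CLmap k.proj.toLinearMap 2 u, 0) = 0 := by
    rw [← e]
    exact (coneD_coneMap k.proj (k.proj_mem_quot (n := n)) 1 (u, 0)).trans
      (by rw [LinearMap.mem_ker.1 h, map_zero])
  exact ⟨hz, congrArg _ (Subtype.ext e.symm)⟩

/-- If `k ⊆ n`, then `CL_*(g) → CL_*(g/n)` and `CL_*(g) → CL_*((g/k)/(n/k))` have the same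
kernel. -/
theorem CLmap_quot_proj_eq_zero {n k : Ideal F g} (hkn : k.toSubmodule ≤ n.toSubmodule) {m : ℕ}
    (u : CL F g m) :
    CLmap (n.quot k).proj.toLinearMap m (CLmap k.proj.toLinearMap m u) = 0 ↔
      CLmap n.proj.toLinearMap m u = 0 := by
  have e : (n.quot k).proj.toLinearMap ∘ₗ k.proj.toLinearMap =
      (quotMap k.proj (k.proj_mem_quot (n := n))).toLinearMap ∘ₗ
        n.proj.toLinearMap := rfl
  -- The projections of g to g/n and to (g/k)/(n/k) factor through each other, hence so do the
  -- induced maps on chains; k ⊆ n is what makes the factorisation by `r` possible.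
  let r₀ : Quo k →ₗ[F] Quo n := k.toSubmodule.liftQ n.proj.toLinearMap
    (fun a ha => (n.proj_eq_zero a).2 (hkn ha))
  let r : Quo (n.quot k) →ₗ[F] Quo n := (n.quot k).toSubmodule.liftQ r₀ (by
    rintro _ ⟨a, ha, rfl⟩
    exact (n.proj_eq_zero a).2 ha)
  have e' : r ∘ₗ (n.quot k).proj.toLinearMap ∘ₗ k.proj.toLinearMap = n.proj.toLinearMap := rfl
  simp only [CLmap, ← LinearMap.comp_apply, ← PiTensorProduct.map_comp]
  constructor
  · intro h
    rw [← e', PiTensorProduct.map_comp (fun _ => r)]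
    rw [LinearMap.comp_apply, h, map_zero]
  · intro h
    rw [e, PiTensorProduct.map_comp, LinearMap.comp_apply, h, map_zero]

/-- This is surjectivity of K(g, n) → K(g/k, n/k): any lift of the chain to g lies in the right
kernel automatically, because the two kernels on g coincide. -/
theorem exists_lift {n k : Ideal F g} (hkn : k.toSubmodule ≤ n.toSubmodule) {m : ℕ}
    {v : CL F (Quo k) m} (hv : CLmap (n.quot k).proj.toLinearMap m v = 0) :
    ∃ u : CL F g m, CLmap n.proj.toLinearMap m u = 0 ∧ CLmap k.proj.toLinearMap m u = v := by
  obtain ⟨u, rfl⟩ := CLmap_surjective _ k.proj_surjective m v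
  exact ⟨u, (CLmap_quot_proj_eq_zero hkn u).1 hv, rfl⟩

/-- If the image of a relative chain `u` of `(g, n)` is a boundary over `g/k`, then `u` is a
boundary up to a chain with entries in `k`. -/
theorem exists_boundary_add {n k : Ideal F g} (hkn : k.toSubmodule ≤ n.toSubmodule) {u : CL F g 2}
    (hu : CLmap n.proj.toLinearMap 2 u = 0)
    (h : Represents (I := n.quot k) (n := 1) (CLmap k.proj.toLinearMap 2 u, 0) 0) :
    ∃ v : CL F g 3, CLmap n.proj.toLinearMap 3 v = 0 ∧
      CLmap k.proj.toLinearMap 2 (u - boundary F g 2 v) = 0 := by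
  obtain ⟨w, hw, e⟩ := (represents_zero_iff ((CLmap_quot_proj_eq_zero hkn u).2 hu)).1 h
  obtain ⟨v, hv, rfl⟩ := exists_lift hkn hw
  exact ⟨v, hv, by rw [map_sub, ← boundary_CLmap, e, sub_self]⟩

end RelativeCycles

/-! ### Linear maps out of a presented algebra that kill products -/

section AbelianLift

variable {F : Type u} {X : Type v} {V : Type w} [Field F] [AddCommGroup V] [Module F V]

/-- The extension of `f : X → V` to the free magma on `X` that vanishes on products. -/
def magmaExtend (f : X → V) : FreeMagma X → V
  | .of x => f x
  | .mul _ _ => 0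

/-- The linear map on the free non-associative algebra on `X` that extends `f : X → V` and
vanishes on products. -/
noncomputable def mulZeroLift (f : X → V) : FreeNonUnitalNonAssocAlgebra F X →ₗ[F] V :=
  Finsupp.linearCombination F (magmaExtend f) ∘ₗ (MonoidAlgebra.coeffLinearEquiv F).toLinearMap

theorem mulZeroLift_single (f : X → V) (w : FreeMagma X) (r : F) :
    mulZeroLift f (MonoidAlgebra.single w r) = r • magmaExtend f w := by
  simp [mulZeroLift]

theorem mulZeroLift_of (f : X → V) (x : X) :
    mulZeroLift (F := F) f (FreeNonUnitalNonAssocAlgebra.of F x) = f x := by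
  have := mulZeroLift_single (F := F) f (FreeMagma.of x) 1
  rwa [one_smul] at this

theorem mulZeroLift_mul (f : X → V) (p q : FreeNonUnitalNonAssocAlgebra F X) :
    mulZeroLift f (p * q) = 0 := by
  induction p using MonoidAlgebra.induction_linear with
  | zero => simp
  | add p p' hp hp' => rw [add_mul, map_add, hp, hp', add_zero]
  | single w r =>
    induction q using MonoidAlgebra.induction_linear with
    | zero => simp
    | add q q' hq hq' => rw [mul_add, map_add, hq, hq', add_zero]
    | single w' r' =>
      rw [MonoidAlgebra.single_mul_single, mulZeroLift_single]
      exact smul_zero _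

theorem mulZeroLift_mem (f : X → V) {S : Submodule F V} (hf : ∀ x, f x ∈ S)
    (p : FreeNonUnitalNonAssocAlgebra F X) : mulZeroLift f p ∈ S := by
  induction p using MonoidAlgebra.induction_linear with
  | zero => simp
  | add p p' hp hp' => rw [map_add]; exact add_mem hp hp'
  | single w r =>
    rw [mulZeroLift_single]
    refine Submodule.smul_mem _ _ ?_
    cases w with
    | of x => exact hf x
    | mul _ _ => exact S.zero_mem

/-- The kernel contains every product, so it is a two-sided ideal and contains the Leibniz relators;
only `rels` has to be checked. -/
theorem presIdeal_le_ker_mulZeroLift {rels : Set (FreeNonUnitalNonAssocAlgebra F X)} {f : X → V}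
    (hf : ∀ r ∈ rels, mulZeroLift f r = 0) :
    presIdeal rels ≤ LinearMap.ker (mulZeroLift f) := by
  refine sInf_le ⟨fun a b _ => ⟨mulZeroLift_mul f a b, mulZeroLift_mul f b a⟩, fun x y z => ?_, hf⟩
  simp [mulZeroLift_mul]

end AbelianLift

/-! ### Maps out of the exterior product with a central ideal -/

section Exterior

variable {F : Type u} {g : Type v} {V : Type w} [Field F] [AddCommGroup g] [Module F g]
  [LeibnizAlgebra F g] [AddCommGroup V] [Module F V]

/-- For a central ideal `k`, a pair of bilinear maps that agree on `k` and vanish on brackets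
induces a linear map on `g ⋏ k` that vanishes on brackets. -/
theorem exists_exterior_lift {k : Ideal F g}
    (hk : ∀ a ∈ k.toSubmodule, ∀ x, br F x a = 0 ∧ br F a x = 0)
    (φ : g →ₗ[F] k →ₗ[F] V) (ψ : k →ₗ[F] g →ₗ[F] V) (hφψ : ∀ a a' : k, φ a a' = ψ a a')
    (hφ : ∀ x y a, φ (br F x y) a = 0) (hψ : ∀ a x y, ψ a (br F x y) = 0) :
    ∃ α : Exterior (CrossedModule.id F g) k.crossed →ₗ[F] V,
      (∀ x a, α (eMN _ _ x a) = φ x a) ∧ (∀ a x, α (eNM _ _ a x) = ψ a x) ∧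
      (∀ s t, α (br F s t) = 0) ∧
      ∀ S : Submodule F V, (∀ x a, φ x a ∈ S) → (∀ a x, ψ a x ∈ S) → ∀ t, α t ∈ S := by
  let f : (g × k) ⊕ (k × g) → V := Sum.elim (fun p => φ p.1 p.2) (fun p => ψ p.1 p.2)
  have hf₁ (x : g) (a : k) : mulZeroLift f (sMN F x a) = φ x a := mulZeroLift_of f _
  have hf₂ (a : k) (x : g) : mulZeroLift f (sNM F a x) = ψ a x := mulZeroLift_of f _
  -- Both mutual actions are trivial, and so is the bracket of k. Each defining relation therefore
  -- reduces to bilinearity, to vanishing on brackets of g, or to 0 = 0.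
  have hl (x : g) (a : k) : k.crossed.left x a = 0 := Subtype.ext (hk a a.2 x).1
  have hr (x : g) (a : k) : k.crossed.right a x = 0 := Subtype.ext (hk a a.2 x).2
  have hl' (x : g) (a : k) : (CrossedModule.id F g).left (k.crossed.hom a) x = 0 := (hk a a.2 x).2
  have hr' (x : g) (a : k) : (CrossedModule.id F g).right x (k.crossed.hom a) = 0 :=
    (hk a a.2 x).1
  have hkk (a b : k) : br F a b = 0 := Subtype.ext (hk b b.2 a).1
  have hrel : ∀ r ∈ tensorRels (CrossedModule.id F g) k.crossed, mulZeroLift f r = 0 := by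
    rintro _ ⟨p, q, h, rfl⟩
    rw [map_sub, sub_eq_zero]
    cases h <;>
      simp only [map_add, map_sub, map_neg, map_smul, mulZeroLift_mul, hf₁, hf₂, hl, hr, hl', hr',
        hkk, hφ, hψ, map_zero, LinearMap.add_apply, LinearMap.smul_apply, LinearMap.zero_apply,
        sub_zero, neg_zero]
  let α₀ : Tensor (CrossedModule.id F g) k.crossed →ₗ[F] V :=
    (presIdeal _).liftQ (mulZeroLift f) (presIdeal_le_ker_mulZeroLift hrel)
  have h₁ (x : g) (a : k) : α₀ (tMN _ _ x a) = φ x a := hf₁ x a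
  have h₂ (a : k) (x : g) : α₀ (tNM _ _ a x) = ψ a x := hf₂ a x
  have hsq : squareSpan (CrossedModule.id F g) k.crossed ≤ LinearMap.ker α₀ := by
    rw [squareSpan, Submodule.span_le]
    rintro _ ⟨a, a', b, b', rfl, rfl, rfl⟩
    change α₀ _ = 0
    rw [map_sub, h₁, h₂, sub_eq_zero]
    exact hφψ b b'
  refine ⟨(squareSpan _ _).liftQ α₀ hsq, h₁, h₂, fun s t => ?_, fun S hS₁ hS₂ t => ?_⟩
  · obtain ⟨s, rfl⟩ := (square _ _).proj_surjective s
    obtain ⟨t, rfl⟩ := (square _ _).proj_surjective t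
    obtain ⟨s, rfl⟩ := Presented.mk_surjective _ s
    obtain ⟨t, rfl⟩ := Presented.mk_surjective _ t
    exact mulZeroLift_mul f s t
  · obtain ⟨t, rfl⟩ := (square _ _).proj_surjective t
    obtain ⟨t, rfl⟩ := Presented.mk_surjective _ t
    -- Products map to zero, so the image lies in any subspace containing the values on generators.
    refine mulZeroLift_mem f ?_ t
    rintro (⟨x, a⟩ | ⟨a, x⟩)
    · exact hS₁ x a
    · exact hS₂ a x

end Exterior

/-! ### The maps α and γ, and exactness -/

section ExactSequence

variable {F : Type u} {g : Type v} [Field F] [AddCommGroup g] [Module F g] [LeibnizAlgebra F g]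

omit [LeibnizAlgebra F g] in
theorem mixedSpan_mono {I J : Submodule F g} (h : I ≤ J) : mixedSpan I ≤ mixedSpan J :=
  Submodule.span_mono fun _ ⟨x, a, ha, e⟩ => ⟨x, a, h ha, e⟩

/-- For a central ideal `k ⊆ n`, the homomorphism `g ⋏ k → HL_2(g, n)` given by
`x ⋏ a ↦ x ⊗ a` and `a ⋏ x ↦ a ⊗ x`. -/
theorem exists_exterior_hom {n k : Ideal F g} (hkn : k.toSubmodule ≤ n.toSubmodule)
    (hk : ∀ a ∈ k.toSubmodule, ∀ x, br F x a = 0 ∧ br F a x = 0) :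
    ∃ α : Hom F (Exterior (CrossedModule.id F g) k.crossed) (HL₂ n),
      (∀ (x : g) (a : k), Represents (I := n) (n := 1) (pure₂ x (a : g), 0) (α (eMN _ _ x a))) ∧
      (∀ (a : k) (x : g), Represents (I := n) (n := 1) (pure₂ (a : g) x, 0) (α (eNM _ _ a x))) ∧
      ∀ t, HL₂proj n k (α t) = 0 := by
  have hcyc (u : CL F g 2) (hu : u ∈ mixedSpan k.toSubmodule) :
      ((u, 0) : Cone n 2) ∈ LinearMap.ker (coneD n 1) :=
    mem_ker_coneD ((CLmap_proj_two_eq_zero n u).2 (mixedSpan_mono hkn hu))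
      (boundary_eq_zero_of_central hk ((CLmap_proj_two_eq_zero k u).2 hu))
  -- Taking classes is one linear map on the whole span of mixed tensors, so φ and ψ inherit
  -- bilinearity from the tensor product. They agree on k because both give the class of a ⊗ a'.
  let cls : mixedSpan k.toSubmodule →ₗ[F] HL₂ n := RelHL.mk n 1 ∘ₗ
    (LinearMap.inl F (CL F g 2) (CL F (Quo n) 3) ∘ₗ (mixedSpan k.toSubmodule).subtype).codRestrict
      (LinearMap.ker (coneD n 1)) (fun u => hcyc u u.2)
  have hcls (u : mixedSpan k.toSubmodule) : Represents (I := n) (n := 1) (u, 0) (cls u) :=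
    ⟨hcyc u u.2, rfl⟩
  have hm₁ (x : g) (a : k) : pure₂ x (a : g) ∈ mixedSpan k.toSubmodule :=
    Submodule.subset_span ⟨x, a, a.2, Or.inl rfl⟩
  have hm₂ (a : k) (x : g) : pure₂ (a : g) x ∈ mixedSpan k.toSubmodule :=
    Submodule.subset_span ⟨x, a, a.2, Or.inr rfl⟩
  let φ : g →ₗ[F] k →ₗ[F] HL₂ n := LinearMap.mk₂ F (fun x a => cls ⟨pure₂ x (a : g), hm₁ x a⟩)
    (fun x y a => by rw [← map_add]; congr 1; ext1; simp)
    (fun r x a => by rw [← map_smul]; congr 1; ext1; simp)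
    (fun x a b => by rw [← map_add]; congr 1; ext1; simp)
    (fun r x a => by rw [← map_smul]; congr 1; ext1; simp)
  let ψ : k →ₗ[F] g →ₗ[F] HL₂ n := LinearMap.mk₂ F (fun a x => cls ⟨pure₂ (a : g) x, hm₂ a x⟩)
    (fun x y a => by rw [← map_add]; congr 1; ext1; simp)
    (fun r x a => by rw [← map_smul]; congr 1; ext1; simp)
    (fun x a b => by rw [← map_add]; congr 1; ext1; simp)
    (fun r x a => by rw [← map_smul]; congr 1; ext1; simp)
  have hφ (x : g) (a : k) : Represents (I := n) (n := 1) (pure₂ x (a : g), 0) (φ x a) :=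
    hcls ⟨_, hm₁ x a⟩
  have hψ (a : k) (x : g) : Represents (I := n) (n := 1) (pure₂ (a : g) x, 0) (ψ a x) :=
    hcls ⟨_, hm₂ a x⟩
  have hproj (x : Fin 3 → g) (i : Fin 3) (hi : x i ∈ n.toSubmodule) :
      CLmap n.proj.toLinearMap 3 (PiTensorProduct.tprod F x) = 0 := by
    rw [CLmap, PiTensorProduct.map_tprod]
    exact (PiTensorProduct.tprod F).map_coord_zero i ((n.proj_eq_zero _).2 hi)
  obtain ⟨α, h₁, h₂, h₃, h₄⟩ := exists_exterior_lift hk φ ψ (fun _ _ => rfl)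
    (fun x y a => by
      refine (hφ _ a).unique ((represents_zero_iff
        ((CLmap_proj_two_eq_zero n _).2 (mixedSpan_mono hkn (hm₁ _ a)))).2
        -- As [x, a] = [y, a] = 0, the boundary of x ⊗ y ⊗ a is [x, y] ⊗ a.
        ⟨PiTensorProduct.tprod F ![x, y, a], hproj _ 2 (hkn a.2), ?_⟩)
      rw [boundary_three]
      simp [(hk a a.2 _).1])
    (fun a x y => by
      refine (hψ a _).unique ((represents_zero_iff
        ((CLmap_proj_two_eq_zero n _).2 (mixedSpan_mono hkn (hm₂ a _)))).2
        -- As [a, x] = [a, y] = 0, the boundary of a ⊗ x ⊗ y is -a ⊗ [x, y], whence the sign.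
        ⟨-PiTensorProduct.tprod F ![(a : g), x, y], ?_, ?_⟩)
      · rw [map_neg, hproj _ 0 (hkn a.2), neg_zero]
      · rw [map_neg, boundary_three]
        simp [(hk a a.2 _).2])
  have hker {u : CL F g 2} {c : HL₂ n} (hu : u ∈ mixedSpan k.toSubmodule)
      (h : Represents (I := n) (n := 1) (u, 0) c) : HL₂proj n k c = 0 := by
    refine h.map.unique ?_
    rw [(CLmap_proj_two_eq_zero k u).2 hu]
    exact ⟨zero_mem _, map_zero _⟩
  refine ⟨{ toLinearMap := α, map_br := h₃ }, fun x a => ?_, fun a x => ?_, fun t => ?_⟩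
  · change Represents _ (α _)
    rw [h₁]
    exact hφ x a
  · change Represents _ (α _)
    rw [h₂]
    exact hψ a x
  · exact h₄ (LinearMap.ker (HL₂proj n k).toLinearMap) (fun x a => hker (hm₁ x a) (hφ x a))
      (fun a x => hker (hm₂ a x) (hψ a x)) t

/-- A class dying over g/k is represented, after subtracting a relative boundary, by a chain in the
span of the x ⊗ a and a ⊗ x with a ∈ k. Every chain there represents a value of α. -/
theorem exact_exterior_hom {n k : Ideal F g} (hkn : k.toSubmodule ≤ n.toSubmodule)
    {α : Hom F (Exterior (CrossedModule.id F g) k.crossed) (HL₂ n)}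
    (h₁ : ∀ (x : g) (a : k),
      Represents (I := n) (n := 1) (pure₂ x (a : g), 0) (α (eMN _ _ x a)))
    (h₂ : ∀ (a : k) (x : g),
      Represents (I := n) (n := 1) (pure₂ (a : g) x, 0) (α (eNM _ _ a x)))
    (h₀ : ∀ t, HL₂proj n k (α t) = 0) : Function.Exact α (HL₂proj n k) := by
  intro c
  refine ⟨fun hc => ?_, ?_⟩
  · obtain ⟨u, hu, h⟩ := exists_represents c
    obtain ⟨v, hv, hw⟩ := exists_boundary_add hkn hu (hc ▸ h.map (k := k))
    have hv' : Represents (I := n) (n := 1) (boundary F g 2 v, 0) 0 :=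
      (represents_zero_iff (by rw [← boundary_CLmap, hv, map_zero])).2 ⟨v, hv, rfl⟩
    have key : ∀ w ∈ mixedSpan k.toSubmodule,
        ∃ t, Represents (I := n) (n := 1) (w, 0) (α t) := by
      intro w hw
      induction hw using Submodule.span_induction with
      | mem w hw =>
        obtain ⟨x, a, ha, rfl | rfl⟩ := hw
        · exact ⟨_, h₁ x ⟨a, ha⟩⟩
        · exact ⟨_, h₂ ⟨a, ha⟩ x⟩
      | zero => exact ⟨0, zero_mem _, (map_zero _).trans (map_zero α.toLinearMap).symm⟩
      | add w w' _ _ hw hw' =>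
        obtain ⟨t, ht⟩ := hw
        obtain ⟨t', ht'⟩ := hw'
        exact ⟨t + t', by rw [map_add]; exact ht.add ht'⟩
      | smul r w _ hw =>
        obtain ⟨t, ht⟩ := hw
        exact ⟨r • t, by rw [map_smul]; exact ht.smul r⟩
    obtain ⟨t, ht⟩ := key _ ((CLmap_proj_two_eq_zero k _).1 hw)
    refine ⟨t, ht.unique ?_⟩
    simpa using h.sub hv'
  · rintro ⟨t, rfl⟩
    exact h₀ t

/-- For a central ideal `k ⊆ n`, the connecting homomorphism `HL_2(g/k, n/k) → [g, n] ∩ k`. -/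
theorem exists_connecting_hom {n k : Ideal F g} (hkn : k.toSubmodule ≤ n.toSubmodule)
    (hk : ∀ a ∈ k.toSubmodule, ∀ x, br F x a = 0 ∧ br F a x = 0) :
    ∃ γ : Hom F (HL₂ (n.quot k)) (commutator n ⊓ k : Ideal F g).toSubmodule,
      ∀ (u : CL F g 2) (c : HL₂ (n.quot k)), CLmap n.proj.toLinearMap 2 u = 0 →
        Represents (I := n.quot k) (n := 1) (CLmap k.proj.toLinearMap 2 u, 0) c →
        boundary F g 1 u = pure₁ (γ c : g) := by
  have hex (c : HL₂ (n.quot k)) : ∃ z : (commutator n ⊓ k : Ideal F g).toSubmodule,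
      ∃ u : CL F g 2, CLmap n.proj.toLinearMap 2 u = 0 ∧
        Represents (I := n.quot k) (n := 1) (CLmap k.proj.toLinearMap 2 u, 0) c ∧
        boundary F g 1 u = pure₁ (z : g) := by
    obtain ⟨w, hw, h⟩ := exists_represents c
    obtain ⟨u, hu, rfl⟩ := exists_lift hkn hw
    -- The boundary of u lies in [g, n] because u is a relative chain, and in k because the image of
    -- u over g/k is a cycle.
    have hb : boundary F g 1 u ∈ (mixedSpan n.toSubmodule).map (boundary F g 1) :=
      ⟨u, (CLmap_proj_two_eq_zero n u).1 hu, rfl⟩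
    rw [map_boundary_mixedSpan] at hb
    obtain ⟨z, hz, e⟩ := hb
    change pure₁ z = _ at e
    have hzk : z ∈ k.toSubmodule := by
      have := h.boundary_eq_zero
      rw [boundary_CLmap, ← e, CLmap_pure₁, LinearEquiv.map_eq_zero_iff] at this
      exact (k.proj_eq_zero z).1 this
    exact ⟨⟨z, hz, hzk⟩, u, hu, h, e.symm⟩
  choose z u hu h e using hex
  -- Two lifts of representatives of c differ by a boundary plus a chain of K(g, k), and both have
  -- zero boundary. This independence also yields linearity of the chosen function `z`.
  have huniq {w : CL F g 2} {c : HL₂ (n.quot k)} (hw : CLmap n.proj.toLinearMap 2 w = 0)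
      (hc : Represents (I := n.quot k) (n := 1) (CLmap k.proj.toLinearMap 2 w, 0) c) :
      boundary F g 1 w = pure₁ (z c : g) := by
    have h₀ : Represents (I := n.quot k) (n := 1)
        (CLmap k.proj.toLinearMap 2 (w - u c), 0) 0 := by
      rw [map_sub]
      simpa using hc.sub (h c)
    obtain ⟨v, -, hv⟩ := exists_boundary_add hkn (by rw [map_sub, hw, hu, sub_zero]) h₀
    have := boundary_eq_zero_of_central hk hv
    rw [map_sub, boundary_boundary_two, sub_zero, map_sub, sub_eq_zero] at this
    rw [this, e]
  let γ : HL₂ (n.quot k) →ₗ[F] (commutator n ⊓ k : Ideal F g).toSubmodule :=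
    { toFun := z
      map_add' := fun c c' => by
        refine Subtype.ext (pure₁ (F := F).injective ?_)
        rw [← huniq (w := u c + u c') (by rw [map_add, hu, hu, add_zero])
          (by rw [map_add]; exact (h c).add (h c')), Submodule.coe_add, map_add, map_add, e, e]
      map_smul' := fun r c => by
        refine Subtype.ext (pure₁ (F := F).injective ?_)
        rw [← huniq (w := r • u c) (by rw [map_smul, hu, smul_zero])
          (by rw [map_smul]; exact (h c).smul r), RingHom.id_apply, Submodule.coe_smul, map_smul,
          map_smul, e] }
  refine ⟨{ toLinearMap := γ, map_br := fun c c' => ?_ }, fun w c hw hc => huniq hw hc⟩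
  -- Brackets vanish on both sides: homology is abelian, and the values of γ lie in the central
  -- ideal k.
  exact (map_zero γ).trans (Subtype.ext (hk _ (γ c').2.2 _).1.symm)

/-- If γ kills c, a lift of a representing cycle has zero boundary, so it is itself a relative cycle
over g and its class maps to c. Conversely, a class from g has a cycle as lift. -/
theorem exact_connecting_hom {n k : Ideal F g} (hkn : k.toSubmodule ≤ n.toSubmodule)
    {γ : Hom F (HL₂ (n.quot k)) (commutator n ⊓ k : Ideal F g).toSubmodule}
    (hγ : ∀ (u : CL F g 2) (c : HL₂ (n.quot k)), CLmap n.proj.toLinearMap 2 u = 0 →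
      Represents (I := n.quot k) (n := 1) (CLmap k.proj.toLinearMap 2 u, 0) c →
      boundary F g 1 u = pure₁ (γ c : g)) : Function.Exact (HL₂proj n k) γ := by
  intro c
  constructor
  · intro hc
    obtain ⟨w, hw, h⟩ := exists_represents c
    obtain ⟨u, hu, rfl⟩ := exists_lift hkn hw
    have hd := hγ u c hu h
    rw [hc, Submodule.coe_zero, map_zero] at hd
    have hr : Represents (I := n) (n := 1) (u, 0) _ := ⟨mem_ker_coneD hu hd, rfl⟩
    exact ⟨_, hr.map.unique h⟩
  · rintro ⟨c, rfl⟩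
    obtain ⟨u, hu, h⟩ := exists_represents c
    have := hγ u _ hu h.map
    rw [h.boundary_eq_zero] at this
    exact Subtype.ext (pure₁ (F := F).injective (this.symm.trans (map_zero _).symm))

/-- An element of [g, n] is the boundary of a relative chain u; when it also lies in k, the image of
u over g/k is a cycle, and γ sends its class back to the element. -/
theorem connecting_hom_surjective {n k : Ideal F g} (hkn : k.toSubmodule ≤ n.toSubmodule)
    {γ : Hom F (HL₂ (n.quot k)) (commutator n ⊓ k : Ideal F g).toSubmodule}
    (hγ : ∀ (u : CL F g 2) (c : HL₂ (n.quot k)), CLmap n.proj.toLinearMap 2 u = 0 →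
      Represents (I := n.quot k) (n := 1) (CLmap k.proj.toLinearMap 2 u, 0) c →
      boundary F g 1 u = pure₁ (γ c : g)) : Function.Surjective γ := by
  rintro ⟨z, hz, hzk⟩
  have hb : pure₁ z ∈ (commutator n).toSubmodule.map (pure₁ (F := F) (g := g)).toLinearMap :=
    ⟨z, hz, rfl⟩
  rw [← map_boundary_mixedSpan] at hb
  obtain ⟨u, hu, e⟩ := hb
  have hu := (CLmap_proj_two_eq_zero n u).2 hu
  have hd : boundary F (Quo k) 1 (CLmap k.proj.toLinearMap 2 u) = 0 := by
    rw [boundary_CLmap, e, CLmap_pure₁, LinearEquiv.map_eq_zero_iff]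
    exact (k.proj_eq_zero z).2 hzk
  have hr : Represents (I := n.quot k) (n := 1) (CLmap k.proj.toLinearMap 2 u, 0) _ :=
    ⟨mem_ker_coneD ((CLmap_quot_proj_eq_zero hkn u).2 hu) hd, rfl⟩
  exact ⟨_, Subtype.ext (pure₁ (F := F).injective ((hγ u _ hu hr).symm.trans e))⟩

end ExactSequence

end Leib

theorem proposition3p7 {F : Type*} {g : Type*} [Field F] [AddCommGroup g] [Module F g]
    [LeibnizAlgebra F g] (n k : Leib.Ideal F g) (hk : k.toSubmodule ≤ Leib.relCenter n) :
    ∃ (α : Leib.Hom F (Leib.Exterior (Leib.CrossedModule.id F g) k.crossed) (Leib.HL₂ n))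
      (γ : Leib.Hom F (Leib.HL₂ (n.quot k)) (Leib.commutator n ⊓ k : Leib.Ideal F g).toSubmodule),
      -- exactness of `g ⋏ k → HL₂(g, n) → HL₂(g/k, n/k) ↠ [g, n] ∩ k`
      Function.Exact α (Leib.HL₂proj n k) ∧
      Function.Exact (Leib.HL₂proj n k) γ ∧
      Function.Surjective γ ∧
      -- description of `α` on generators
      (∀ (x : g) (a : k), Leib.Represents (I := n) (n := 1)
        (PiTensorProduct.tprod F ![x, (a : g)], 0) (α (Leib.eMN _ _ x a))) ∧
      (∀ (a : k) (x : g), Leib.Represents (I := n) (n := 1)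
        (PiTensorProduct.tprod F ![(a : g), x], 0) (α (Leib.eNM _ _ a x))) ∧
      -- description of `γ`: it is given by the commutator of a lift
      (∀ (u : Leib.CL F g 2) (c : Leib.HL₂ (n.quot k)),
        Leib.CLmap n.proj.toLinearMap 2 u = 0 →
        Leib.Represents (I := n.quot k) (n := 1) (Leib.CLmap k.proj.toLinearMap 2 u, 0) c →
        Leib.boundary F g 1 u = PiTensorProduct.tprod F (fun _ : Fin 1 => (γ c : g))) := by
  have hkn : k.toSubmodule ≤ n.toSubmodule := fun a ha => (hk ha).1
  have hkc : ∀ a ∈ k.toSubmodule, ∀ x, Leib.br F x a = 0 ∧ Leib.br F a x = 0 :=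
    fun a ha => (hk ha).2
  obtain ⟨α, h₁, h₂, h₀⟩ := Leib.exists_exterior_hom hkn hkc
  obtain ⟨γ, hγ⟩ := Leib.exists_connecting_hom hkn hkc
  refine ⟨α, γ, Leib.exact_exterior_hom hkn h₁ h₂ h₀, Leib.exact_connecting_hom hkn hγ,
    Leib.connecting_hom_surjective hkn hγ, h₁, h₂, fun u c hu hc => ?_⟩
  rw [← Leib.pure₁_apply]
  exact hγ u c hu hc
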